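/- Let $G=(V,E,m,w)$ be a weighted graph: $(V,E)$ is a connected, locally finite, simple undirected graph with combinatorial distance $d$, and $m:V\to(0,\infty)$ and $w:E\to(0,\infty)$, $w(x,y)=w(y,x)$, are vertex and edge weights. Assume that $G$ has bounded geometry, that is, there is $C>0$ such that $\deg(x)\le C$ and $C^{-1}\le m(x)\le C$ for all $x\in V$, and $C^{-1}\le w(x,y)\le C$ for all $x\sim y$. Write $B_R(x)=\{y: d(y,x)\le R\}$, $S_R(x)=\{y:d(y,x)=R\}$ and $\Delta f(x)=\sum_{y\sim x}\frac{w(x,y)}{m(x)}(f(y)-f(x))$. Let $x_0\in V$ and $R_0\in\mathbb N$ (possibly $R_0=0$), and suppose that at least one of the following holds. (a) $\mathcal K_\infty(x)\ge 0$ for all $x\in V\setminus B_{R_0}(x_0)$. Here the Bakry–Émery curvature $\mathcal K_\infty(x)$ is the supremum in $[-\infty,\infty]$ of all $K\in\mathbb R$ such that $\Gamma_2(f,f)(x)\ge K\,\Gamma(f,f)(x)$ for every $f:V\to\mathbb R$, where $\Gamma(f,g)=\frac12(\Delta(fg)-f\Delta g-g\Delta f)$ and $\Gamma_2(f,g)=\frac12(\Delta\Gamma(f,g)-\Gamma(f,\Delta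 g)-\Gamma(g,\Delta f))$. (b) $\kappa(x,y)\ge0$ for every edge $\{x,y\}$ with $x,y\in V\setminus B_{R_0}(x_0)$. Here the Ollivier curvature is $\kappa(x,y)=\inf\nabla_{xy}\Delta f$, the infimum over all $f:V\to\mathbb R$ with $\nabla_{yx}f=1$ and $\sup_{u\sim v}\nabla_{uv}f=1$, where $\nabla_{xy}f=\frac{f(x)-f(y)}{d(x,y)}$. For a finite set $\Omega\subset V$, an end with respect to $\Omega$ is an infinite connected component $\Pi$ of the subgraph induced on $V\setminus\Omega$. Let $\partial\Pi$ be the set of vertices outside $\Pi$ that have a neighbour in $\Pi$. The end $\Pi$ is called non-parabolic if there is a function $f:\Pi\cup\partial\Pi\to(0,\infty)$ with $\Delta f=0$ on $\Pi$, $f=1$ on $\partial\Pi$, and $\liminf_{x\to\infty,\,x\in\Pi}f(x)<1$. Let $N^0_\Omega(G)$ be the number of non-parabolic ends with respect to $\Omega$. The number of non-parabolic ends of $G$ is $N^0(G)=\lim_{i\to\infty}N^0_{\Omega_i}(G)$ for an exhaustion $\Omega_1\subset\Omega_2\subset\cdots$ of $V$ by finite sets. Then $N^0(G)$ is well defined (exhaustions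 exist, and the limit exists, is finite and is the same for every exhaustion), and $$N^0(G)\le \sharp S_{R_0+1}(x_0).$$ -/

import Mathlib

open Filter Topology

/-- A connected, locally finite, simple undirected graph with positive vertex weights `m` and
positive symmetric edge weights `w`. Only the values of `w` on edges are ever used. -/
structure WeightedGraph (V : Type*) where
  graph : SimpleGraph V
  connected : graph.Connected
  locallyFinite : ∀ x, (graph.neighborSet x).Finite
  m : V → ℝ
  m_pos : ∀ x, 0 < m x
  w : V → V → ℝ
  w_symm : ∀ x y, graph.Adj x y → w x y = w y x
  w_pos : ∀ x y, graph.Adj x y → 0 < w x y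

namespace WeightedGraph

variable {V : Type*} (G : WeightedGraph V)

/-- The finite set of neighbours of `x`. -/
noncomputable def nbrs (x : V) : Finset V := (G.locallyFinite x).toFinset

/-- The ball of radius `R` for the combinatorial distance. -/
def ball (x : V) (R : ℕ) : Set V := {y | G.graph.dist y x ≤ R}

/-- The sphere of radius `R` for the combinatorial distance. -/
def sphere (x : V) (R : ℕ) : Set V := {y | G.graph.dist y x = R}

/-- Bounded geometry: degrees bounded above, weights bounded above and away from zero. -/
def BoundedGeometry : Prop :=
  ∃ C : ℝ, 0 < C ∧
    (∀ x, ((G.nbrs x).card : ℝ) ≤ C) ∧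
    (∀ x, C⁻¹ ≤ G.m x ∧ G.m x ≤ C) ∧
    (∀ x y, G.graph.Adj x y → C⁻¹ ≤ G.w x y ∧ G.w x y ≤ C)

/-- The weighted Laplacian. -/
noncomputable def laplacian (f : V → ℝ) (x : V) : ℝ :=
  ∑ y ∈ G.nbrs x, G.w x y / G.m x * (f y - f x)

/-! ### Bakry–Émery curvature -/

/-- The carré du champ operator. -/
noncomputable def gamma (f g : V → ℝ) (x : V) : ℝ :=
  (1 / 2) * (G.laplacian (f * g) x - f x * G.laplacian g x - g x * G.laplacian f x)

/-- The iterated carré du champ operator. -/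
noncomputable def gamma₂ (f g : V → ℝ) (x : V) : ℝ :=
  (1 / 2) * (G.laplacian (G.gamma f g) x - G.gamma f (G.laplacian g) x
    - G.gamma g (G.laplacian f) x)

/-- The condition `CD(K, ∞)` at the vertex `x`. -/
def CDAt (K : ℝ) (x : V) : Prop :=
  ∀ f : V → ℝ, K * G.gamma f f x ≤ G.gamma₂ f f x

/-- The Bakry–Émery curvature (of infinite dimension) at `x`: the largest `K` for which
`CD(K, ∞)` holds at `x`. -/
noncomputable def bakryEmeryCurvature (x : V) : EReal :=
  ⨆ (K : ℝ) (_ : G.CDAt K x), (K : EReal)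

/-- `CD(0, ∞)` outside `Ω`. -/
def CDOutside (Ω : Set V) : Prop :=
  ∀ x, x ∉ Ω → 0 ≤ G.bakryEmeryCurvature x

/-! ### Ollivier curvature -/

/-- The difference quotient `∇_{xy} f = (f x - f y) / d(x, y)`, used for `x ≠ y`. -/
noncomputable def grad (x y : V) (f : V → ℝ) : ℝ := (f x - f y) / G.graph.dist x y

/-- `|∇f|_∞ = c`: the supremum of `∇_{xy} f` over all edges exists and equals `c`. -/
def GradSupEq (f : V → ℝ) (c : ℝ) : Prop :=
  IsLUB {r : ℝ | ∃ x y, G.graph.Adj x y ∧ r = G.grad x y f} c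

/-- The Ollivier curvature `κ(x, y)`, the infimum of `∇_{xy} Δf` over all `f` with
`∇_{yx} f = 1` and `|∇f|_∞ = 1`. -/
noncomputable def ollivierCurvature (x y : V) : EReal :=
  ⨅ (f : V → ℝ) (_ : G.grad y x f = 1) (_ : G.GradSupEq f 1),
    ((G.grad x y (G.laplacian f) : ℝ) : EReal)

/-- Nonnegative Ollivier curvature outside `Ω`: on all edges with both ends outside `Ω`. -/
def NonnegOllivierOutside (Ω : Set V) : Prop :=
  ∀ x y, x ∉ Ω → y ∉ Ω → G.graph.Adj x y → 0 ≤ G.ollivierCurvature x y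

/-! ### Ends -/

/-- The vertex boundary of `K`. -/
def boundary (K : Set V) : Set V := {y | y ∉ K ∧ ∃ x ∈ K, G.graph.Adj x y}

/-- `f` is a barrier function on `E`. Only the values of `f` on the union of `E` with its
boundary matter. The filter expresses that `x` tends to infinity (leaves every finite set) inside
`E`; the lower limit is taken in the extended reals. -/
def IsBarrier (E : Set V) (f : V → ℝ) : Prop :=
  (∀ x ∈ E ∪ G.boundary E, 0 < f x) ∧
  (∀ x ∈ E, G.laplacian f x = 0) ∧
  (∀ x ∈ G.boundary E, f x = 1) ∧
  liminf (fun x => (f x : EReal)) (cofinite ⊓ 𝓟 E) < 1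

/-- The non-parabolic ends with respect to `Ω`: infinite connected components of the induced
graph on the complement of `Ω` that carry a barrier function. -/
def nonparabolicEnds (Ω : Finset V) : Set (G.graph.ComponentCompl (Ω : Set V)) :=
  {C | C.supp.Infinite ∧ ∃ f, G.IsBarrier C.supp f}

/-- An exhaustion of the vertex set by an increasing sequence of finite sets. -/
def IsExhaustion (Ω : ℕ → Finset V) : Prop :=
  (∀ i, Ω i ⊆ Ω (i + 1)) ∧ ∀ x, ∃ i, x ∈ Ω i

/-- `N` is the number of non-parabolic ends of the graph: the limit of the number of non-parabolic
ends with respect to `Ω i`, for every exhaustion `Ω`. (Exhaustions are required to exist, so that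
there is at most one such `N`.) -/
def HasNonparabolicEndCount (N : ℕ∞) : Prop :=
  (∃ Ω, IsExhaustion (V := V) Ω) ∧
  ∀ Ω, IsExhaustion (V := V) Ω →
    Tendsto (fun i => (G.nonparabolicEnds (Ω i)).encard) atTop (𝓝 N)

end WeightedGraph

namespace WeightedGraph

variable {V : Type*} (G : WeightedGraph V)

/-! Non-parabolic ends are counted by linearly independent bounded harmonic functions, and curvature
forces such functions to be determined by their values on the sphere.

Counting: an end is non-parabolic iff it is massive, that is, carries a nonzero bounded subharmonic
function supported in it. Disjoint massive sets yield least harmonic majorants `u i` with `u i + u j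
≤ 1`, each of supremum one, hence linearly independent (`linearIndependent_of_witness`). If
restriction to the sphere is injective on bounded harmonic functions, their number is at most the
number of its vertices (`RateBounds.encard_le_of_unique`).

Uniqueness: a harmonic `f` vanishing on the sphere vanishes on the ball by the maximum principle.
Suppose the supremum of its gradient is positive. Curvature propagates an almost maximal gradient to
a nearby place where `f ^ 2` (Bakry–Émery) or `f` (Ollivier) is larger by a fixed amount. The
gradient defect grows only by a bounded factor, so the step can be iterated as often as desired,
contradicting boundedness (`exists_le_defect`). Thus `f` is constant, hence zero.

Existence of the limit: the count is monotone in nonempty `Ω` and bounded, so it stabilises. -/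

theorem mem_nbrs {x y : V} : y ∈ G.nbrs x ↔ G.graph.Adj x y := by simp [nbrs]

theorem rate_pos {x y : V} (h : G.graph.Adj x y) : 0 < G.w x y / G.m x :=
  div_pos (G.w_pos x y h) (G.m_pos x)

/-- The Laplacian as a linear map. -/
noncomputable def laplacianLin : (V → ℝ) →ₗ[ℝ] (V → ℝ) where
  toFun := G.laplacian
  map_add' f g := by
    ext x
    simp only [laplacian, Pi.add_apply, ← Finset.sum_add_distrib]
    exact Finset.sum_congr rfl fun y _ => by ring
  map_smul' a f := by
    ext x
    simp only [laplacian, Pi.smul_apply, smul_eq_mul, RingHom.id_apply, Finset.mul_sum]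
    exact Finset.sum_congr rfl fun y _ => by ring

theorem laplacian_neg (f : V → ℝ) : G.laplacian (-f) = -G.laplacian f :=
  map_neg G.laplacianLin f

theorem laplacian_sub (f g : V → ℝ) : G.laplacian (f - g) = G.laplacian f - G.laplacian g :=
  map_sub G.laplacianLin f g

theorem laplacian_smul (a : ℝ) (f : V → ℝ) : G.laplacian (a • f) = a • G.laplacian f :=
  map_smul G.laplacianLin a f

theorem laplacian_sum {ι : Type*} (s : Finset ι) (f : ι → V → ℝ) :
    G.laplacian (∑ i ∈ s, f i) = ∑ i ∈ s, G.laplacian (f i) :=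
  map_sum G.laplacianLin f s

theorem laplacian_const (a : ℝ) : G.laplacian (fun _ => a) = 0 := by
  ext x
  simp [laplacian]

theorem laplacian_one_sub (f : V → ℝ) (x : V) :
    G.laplacian (fun y => 1 - f y) x = -G.laplacian f x := by
  have h := G.laplacian_sub (fun _ => 1) f
  rw [laplacian_const, zero_sub] at h
  exact congrFun h x

theorem laplacian_mono_of_le {f g : V → ℝ} {x : V} (hx : f x = g x)
    (h : ∀ y, G.graph.Adj x y → f y ≤ g y) : G.laplacian f x ≤ G.laplacian g x := by
  refine Finset.sum_le_sum fun y hy => ?_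
  rw [mem_nbrs] at hy
  exact mul_le_mul_of_nonneg_left (by rw [hx]; linarith [h y hy]) (G.rate_pos hy).le

/-- Two-sided bounds on the jump rates of the weighted graph. -/
structure RateBounds (c D : ℝ) : Prop where
  lower_pos : 0 < c
  upper_pos : 0 < D
  lower_le : ∀ x y, G.graph.Adj x y → c ≤ G.w x y / G.m x
  sum_le : ∀ x, ∑ y ∈ G.nbrs x, G.w x y / G.m x ≤ D

/-! ### Harnack estimates and the strong maximum principle. -/

variable {G}

theorem BoundedGeometry.exists_rateBounds (hG : G.BoundedGeometry) :
    ∃ c D, G.RateBounds c D := by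
  obtain ⟨C, hC, hdeg, hm, hw⟩ := hG
  refine ⟨C⁻¹ / C, C * (C / C⁻¹), ⟨by positivity, by positivity, fun x y h => ?_, fun x => ?_⟩⟩
  · exact div_le_div₀ (G.w_pos x y h).le (hw x y h).1 (G.m_pos x) (hm x).2
  · have h : ∀ y ∈ G.nbrs x, G.w x y / G.m x ≤ C / C⁻¹ := fun y hy =>
      div_le_div₀ hC.le (hw x y (G.mem_nbrs.1 hy)).2 (by positivity) (hm x).1
    calc _ ≤ (G.nbrs x).card • (C / C⁻¹) := Finset.sum_le_card_nsmul _ _ _ h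
      _ ≤ _ := by
        rw [nsmul_eq_mul]
        exact mul_le_mul_of_nonneg_right (hdeg x) (by positivity)

/-- Recentring at a lower bound `a` of `g` makes every summand nonnegative; this is the source of
the one-step estimates. -/
theorem laplacian_eq_sum_sub (g : V → ℝ) (a : ℝ) (x : V) :
    G.laplacian g x = ∑ z ∈ G.nbrs x, G.w x z / G.m x * (g z - a)
      - (∑ z ∈ G.nbrs x, G.w x z / G.m x) * (g x - a) := by
  rw [laplacian, Finset.sum_mul, ← Finset.sum_sub_distrib]
  exact Finset.sum_congr rfl fun y _ => by ring

/-- One step of the Harnack inequality for functions bounded below by `a` around `x`. -/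
theorem RateBounds.harnack {c D : ℝ} (hb : G.RateBounds c D) {g : V → ℝ} {a : ℝ} {x y : V}
    (hx : a ≤ g x) (h : ∀ z, G.graph.Adj x z → a ≤ g z) (hxy : G.graph.Adj x y) :
    c * (g y - a) ≤ G.laplacian g x + D * (g x - a) := by
  have h1 : G.w x y / G.m x * (g y - a) ≤ ∑ z ∈ G.nbrs x, G.w x z / G.m x * (g z - a) :=
    Finset.single_le_sum (f := fun z => G.w x z / G.m x * (g z - a)) (fun z hz =>
      mul_nonneg (G.rate_pos (G.mem_nbrs.1 hz)).le (by linarith [h z (G.mem_nbrs.1 hz)]))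
      (G.mem_nbrs.2 hxy)
  have h2 := mul_le_mul_of_nonneg_right (hb.lower_le x y hxy) (sub_nonneg.2 (h y hxy))
  have h3 := mul_le_mul_of_nonneg_right (hb.sum_le x) (sub_nonneg.2 hx)
  linarith [laplacian_eq_sum_sub (G := G) g a x]

theorem RateBounds.laplacian_ge {c D : ℝ} (hb : G.RateBounds c D) {g : V → ℝ} {a : ℝ} {x : V}
    (hx : a ≤ g x) (h : ∀ z, G.graph.Adj x z → a ≤ g z) :
    0 ≤ G.laplacian g x + D * (g x - a) := by
  have h1 : 0 ≤ ∑ z ∈ G.nbrs x, G.w x z / G.m x * (g z - a) :=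
    Finset.sum_nonneg (fun z hz =>
      mul_nonneg (G.rate_pos (G.mem_nbrs.1 hz)).le (by linarith [h z (G.mem_nbrs.1 hz)]))
  have h3 := mul_le_mul_of_nonneg_right (hb.sum_le x) (sub_nonneg.2 hx)
  linarith [laplacian_eq_sum_sub (G := G) g a x]

/-- The local strong maximum principle. -/
theorem RateBounds.eq_of_local_max {c D : ℝ} (hb : G.RateBounds c D) {f : V → ℝ} {x y : V}
    (hf : 0 ≤ G.laplacian f x) (h : ∀ z, G.graph.Adj x z → f z ≤ f x) (hxy : G.graph.Adj x y) :
    f y = f x := by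
  have h1 := hb.harnack (g := -f) (a := -f x) (x := x) (y := y) le_rfl
    (fun z hz => neg_le_neg (h z hz)) hxy
  rw [laplacian_neg] at h1
  simp only [Pi.neg_apply, sub_self, mul_zero, add_zero] at h1
  refine le_antisymm (h y hxy) ?_
  by_contra! hlt
  have := mul_pos hb.lower_pos (sub_pos.2 hlt)
  linarith

variable (G) in
theorem forall_of_adj_closed {p : V → Prop} {x : V} (hx : p x)
    (h : ∀ a b, G.graph.Adj a b → p a → p b) (y : V) : p y := by
  obtain ⟨q⟩ := G.connected.preconnected x y
  induction q with
  | nil => exact hx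
  | cons hab _ ih => exact ih (h _ _ hab hx)

/-- A function subharmonic on the whole graph that attains its maximum is constant. -/
theorem RateBounds.eq_of_max {c D : ℝ} (hb : G.RateBounds c D) {f : V → ℝ} {x : V}
    (hf : ∀ z, 0 ≤ G.laplacian f z) (h : ∀ z, f z ≤ f x) (y : V) : f y = f x := by
  refine G.forall_of_adj_closed (p := fun y => f y = f x) rfl (fun a b hab ha => ?_) y
  rw [← ha]
  exact hb.eq_of_local_max (hf a) (fun z _ => ha ▸ h z) hab

/-! ### Distances, balls and the iteration principle. -/

variable (G)

theorem dist_le_dist_add_one {u v : V} (h : G.graph.Adj u v) (x : V) :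
    G.graph.dist u x ≤ G.graph.dist v x + 1 := by
  have h1 := G.connected.dist_triangle (u := u) (v := v) (w := x)
  rw [SimpleGraph.dist_eq_one_iff_adj.2 h] at h1
  omega

theorem exists_adj_dist_add_one {u x : V} (h : u ≠ x) :
    ∃ v, G.graph.Adj u v ∧ G.graph.dist v x + 1 = G.graph.dist u x := by
  obtain ⟨q, hq⟩ := G.connected.exists_walk_length_eq_dist u x
  cases q with
  | nil => exact absurd rfl h
  | @cons _ v _ huv q =>
    refine ⟨v, huv, le_antisymm ?_ (G.dist_le_dist_add_one huv x)⟩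
    rw [← hq, SimpleGraph.Walk.length_cons]
    exact Nat.succ_le_succ (SimpleGraph.dist_le q)

theorem finite_ball (x : V) (R : ℕ) : (G.ball x R).Finite := by
  induction R with
  | zero =>
    refine (Set.finite_singleton x).subset fun y hy => ?_
    exact (G.connected.dist_eq_zero_iff).1 (Nat.le_zero.1 hy)
  | succ R ih =>
    refine (ih.union (ih.biUnion fun y _ => (G.nbrs y).finite_toSet)).subset fun y hy => ?_
    by_cases hyx : y = x
    · exact Or.inl (by simp [ball, hyx])
    · obtain ⟨v, hv, hd⟩ := G.exists_adj_dist_add_one hyx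
      simp only [ball, Set.mem_ofPred_eq] at hy
      exact Or.inr (Set.mem_biUnion
        (show v ∈ G.ball x R by simp only [ball, Set.mem_ofPred_eq]; omega)
        (by simpa [mem_nbrs] using hv.symm))

theorem finite_sphere (x : V) (R : ℕ) : (G.sphere x R).Finite :=
  (G.finite_ball x R).subset fun _ h => (le_of_eq h : _ ≤ R)

theorem ball_eq_univ_of_sphere_eq_empty {x : V} {R : ℕ} (h : G.sphere x (R + 1) = ∅) :
    G.ball x R = Set.univ := by
  refine Set.eq_univ_of_forall (G.forall_of_adj_closed (x := x) (by simp [ball])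
    fun a b hab ha => ?_)
  have h1 := G.dist_le_dist_add_one hab.symm x
  have h2 : b ∉ G.sphere x (R + 1) := by simp [h]
  simp only [ball, sphere, Set.mem_ofPred_eq] at *
  omega

/-- Functions with edge increments at most one are `1`-Lipschitz. -/
theorem sub_le_dist {f : V → ℝ} (h : ∀ a b, G.graph.Adj a b → f b - f a ≤ 1) (u v : V) :
    f u - f v ≤ G.graph.dist u v := by
  obtain ⟨q, hq⟩ := G.connected.exists_walk_length_eq_dist u v
  rw [← hq]
  clear hq
  induction q with
  | nil => simp
  | cons hab _ ih =>
    rw [SimpleGraph.Walk.length_cons, Nat.cast_succ]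
    linarith [h _ _ hab.symm]

/-- A quantity that can be increased by a fixed amount at any point of small defect, at the cost of
a bounded factor in the defect, is unbounded unless the defect is bounded below. -/
theorem exists_le_defect {α : Type*} {δ h : α → ℝ} {A B c η K : ℝ} (hc : 0 < c) (hη : 0 < η)
    (hK : 0 < K) (hA : ∀ a, h a ≤ A) (hB : ∀ a, B ≤ h a)
    (step : ∀ a, δ a ≤ η → ∃ b, δ b ≤ K * δ a ∧ h a + c ≤ h b) :
    ∃ ε > 0, ∀ a, ε ≤ δ a := by
  have key : ∀ n : ℕ, ∃ ε > 0, ∀ a, δ a ≤ ε → ∃ b, h a + n * c ≤ h b := by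
    intro n
    induction n with
    | zero => exact ⟨1, one_pos, fun a _ => ⟨a, by simp⟩⟩
    | succ n ih =>
      obtain ⟨ε, hε, H⟩ := ih
      refine ⟨min η (ε / K), lt_min hη (div_pos hε hK), fun a ha => ?_⟩
      obtain ⟨b, hb, hab⟩ := step a (ha.trans (min_le_left _ _))
      have h1 : K * δ a ≤ ε := by
        have := ha.trans (min_le_right _ _)
        rw [le_div_iff₀ hK] at this
        linarith
      obtain ⟨b', hb'⟩ := H b (hb.trans h1)
      exact ⟨b', by push_cast; linarith⟩
  obtain ⟨n, hn⟩ := exists_nat_gt ((A - B) / c)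
  obtain ⟨ε, hε, H⟩ := key n
  refine ⟨ε, hε, fun a => ?_⟩
  by_contra! hlt
  obtain ⟨b, hb⟩ := H a hlt.le
  rw [div_lt_iff₀ hc] at hn
  linarith [hA b, hB a]

end WeightedGraph

namespace WeightedGraph

variable {V : Type*} {G : WeightedGraph V}

/-! ### Harmonic functions vanishing on a sphere -/

/-- A positive maximum over the ball is attained off the sphere, where all neighbours are still in
the ball. It therefore spreads along edges through the connected graph and reaches a vertex of the
sphere, where `f` is zero. -/
theorem RateBounds.nonpos_on_ball {c D : ℝ} (hb : G.RateBounds c D) {f : V → ℝ} {x₀ : V} {R : ℕ}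
    (hf : ∀ x, 0 ≤ G.laplacian f x) (hS : (G.sphere x₀ (R + 1)).Nonempty)
    (h0 : ∀ x ∈ G.sphere x₀ (R + 1), f x = 0) : ∀ x ∈ G.ball x₀ (R + 1), f x ≤ 0 := by
  obtain ⟨a, ha, hmax⟩ := (G.finite_ball x₀ (R + 1)).exists_maximalFor f _
    ⟨x₀, by simp [ball]⟩
  have hmax' : ∀ z ∈ G.ball x₀ (R + 1), f z ≤ f a := fun z hz => by
    by_contra! hlt
    exact absurd (hmax hz hlt.le) (not_le.2 hlt)
  intro x hx
  refine (hmax' x hx).trans ?_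
  by_contra! hpos
  obtain ⟨s, hs⟩ := hS
  have := G.forall_of_adj_closed (p := fun y => y ∈ G.ball x₀ (R + 1) ∧ f y = f a) ⟨ha, rfl⟩
    (fun y z hyz ⟨hy, hya⟩ => by
      have hyR : G.graph.dist y x₀ ≤ R := by
        have h1 : y ∉ G.sphere x₀ (R + 1) := fun h => by
          rw [h0 y h] at hya
          exact hpos.ne hya
        simp only [ball, sphere, Set.mem_ofPred_eq] at hy h1
        omega
      have hn : ∀ z, G.graph.Adj y z → z ∈ G.ball x₀ (R + 1) := fun z hz => by
        have := G.dist_le_dist_add_one hz.symm x₀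
        simp only [ball, Set.mem_ofPred_eq]
        omega
      refine ⟨hn z hyz, ?_⟩
      rw [← hya]
      exact hb.eq_of_local_max (hf y) (fun z hz => hya ▸ hmax' z (hn z hz)) hyz) s
  rw [h0 s hs] at this
  exact hpos.ne this.2

theorem RateBounds.eq_zero_on_ball {c D : ℝ} (hb : G.RateBounds c D) {f : V → ℝ} {x₀ : V} {R : ℕ}
    (hf : G.laplacian f = 0) (hS : (G.sphere x₀ (R + 1)).Nonempty)
    (h0 : ∀ x ∈ G.sphere x₀ (R + 1), f x = 0) : ∀ x ∈ G.ball x₀ (R + 1), f x = 0 := by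
  intro x hx
  have h1 := hb.nonpos_on_ball (f := f) (fun x => by simp [hf]) hS h0 x hx
  have h2 := hb.nonpos_on_ball (f := -f) (fun x => by simp [laplacian_neg, hf]) hS
    (fun x hx => by simp [h0 x hx]) x hx
  simp only [Pi.neg_apply] at h2
  linarith

theorem mem_ball_succ_of_adj {x₀ x y : V} {R : ℕ} (hx : x ∈ G.ball x₀ R)
    (h : G.graph.Adj x y) : y ∈ G.ball x₀ (R + 1) := by
  have := G.dist_le_dist_add_one h.symm x₀
  simp only [ball, Set.mem_ofPred_eq] at *
  omega

theorem ball_mono {x₀ : V} {R R' : ℕ} (h : R ≤ R') : G.ball x₀ R ⊆ G.ball x₀ R' :=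
  fun _ hx => le_trans (show _ ≤ R from hx) h

/-! ### Nonnegative Bakry–Émery curvature -/

theorem gamma_self (f : V → ℝ) (x : V) :
    G.gamma f f x = (1 / 2) * ∑ y ∈ G.nbrs x, G.w x y / G.m x * (f y - f x) ^ 2 := by
  simp only [gamma, laplacian, Finset.mul_sum, ← Finset.sum_sub_distrib, Pi.mul_apply]
  exact Finset.sum_congr rfl fun y _ => by ring

theorem gamma_self_nonneg (f : V → ℝ) (x : V) : 0 ≤ G.gamma f f x := by
  rw [gamma_self]
  exact mul_nonneg (by norm_num) (Finset.sum_nonneg fun y hy =>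
    mul_nonneg (G.rate_pos (G.mem_nbrs.1 hy)).le (sq_nonneg _))

/-- The supremum need not be known to be attained: `CDAt K` holds for some `K` above any negative
number, and the inequality passes to the limit. -/
theorem CDAt_zero_of_curvature_nonneg {x : V} (h : 0 ≤ G.bakryEmeryCurvature x) : G.CDAt 0 x := by
  intro f
  rw [zero_mul]
  refine le_of_forall_pos_le_add fun ε hε => ?_
  set γ := G.gamma f f x
  have hγ : 0 ≤ γ := gamma_self_nonneg f x
  have hneg : ((-(ε / (γ + 1)) : ℝ) : EReal) < G.bakryEmeryCurvature x :=
    lt_of_lt_of_le (by exact_mod_cast neg_neg_of_pos (by positivity : 0 < ε / (γ + 1))) h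
  simp only [bakryEmeryCurvature, lt_iSup_iff] at hneg
  obtain ⟨K, hK, hlt⟩ := hneg
  have h1 : -(ε / (γ + 1)) < K := by exact_mod_cast hlt
  have h2 := hK f
  have h3 : -(ε / (γ + 1)) * γ ≤ K * γ := mul_le_mul_of_nonneg_right h1.le hγ
  have h4 : ε / (γ + 1) * γ ≤ ε := by
    rw [div_mul_eq_mul_div, div_le_iff₀ (by positivity)]
    nlinarith
  linarith

theorem gamma₂_self_of_harmonic {f : V → ℝ} (hf : G.laplacian f = 0) (x : V) :
    G.gamma₂ f f x = (1 / 2) * G.laplacian (G.gamma f f) x := by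
  have h0 : G.gamma f 0 x = 0 := by simp [gamma, laplacian]
  rw [gamma₂, hf, h0]
  ring

theorem laplacian_sq_of_harmonic {f : V → ℝ} (hf : G.laplacian f = 0) (x : V) :
    G.laplacian (f * f) x = 2 * G.gamma f f x := by
  simp [gamma, hf]

theorem eq_of_gamma_nonpos {f : V → ℝ} (h : ∀ x, G.gamma f f x ≤ 0) (x y : V) : f x = f y := by
  refine G.forall_of_adj_closed (p := fun z => f z = f y) rfl (fun a b hab ha => ?_) x
  have h1 := h a
  rw [gamma_self] at h1
  have h2 : G.w a b / G.m a * (f b - f a) ^ 2 ≤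
      ∑ y ∈ G.nbrs a, G.w a y / G.m a * (f y - f a) ^ 2 :=
    Finset.single_le_sum (f := fun y => G.w a y / G.m a * (f y - f a) ^ 2) (fun y hy =>
      mul_nonneg (G.rate_pos (G.mem_nbrs.1 hy)).le (sq_nonneg _)) (G.mem_nbrs.2 hab)
  have h3 : (f b - f a) ^ 2 ≤ 0 := by
    by_contra! hlt
    have := mul_pos (G.rate_pos hab) hlt
    linarith
  have h4 := pow_eq_zero_iff (two_ne_zero) |>.1 (le_antisymm h3 (sq_nonneg _))
  linarith

/-- `Γ(f,f)` is subharmonic and `Δ(f²) = 2Γ(f,f)`. Where `Γ(f,f)` is near its supremum, `f²` must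
grow towards some neighbour, and Harnack keeps `Γ(f,f)` near its supremum there. -/
theorem RateBounds.eq_zero_of_CDOutside {c D : ℝ} (hb : G.RateBounds c D) {f : V → ℝ} {x₀ : V}
    {R : ℕ} (hcurv : G.CDOutside (G.ball x₀ R)) (hf : G.laplacian f = 0) {A : ℝ}
    (hA : ∀ x, |f x| ≤ A) (h0 : ∀ x ∈ G.ball x₀ (R + 1), f x = 0) (x : V) : f x = 0 := by
  set γ := G.gamma f f with hγ
  have hγ0 : ∀ x, 0 ≤ γ x := gamma_self_nonneg f
  have hsub : ∀ x, 0 ≤ G.laplacian γ x := by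
    intro x
    by_cases hx : x ∈ G.ball x₀ R
    -- All neighbours of `x` lie in the ball of radius `R + 1`, so `γ` attains its minimum zero at
    -- `x`, where no curvature is assumed.
    · have h1 : γ x = 0 := by
        rw [hγ, gamma_self, Finset.sum_eq_zero, mul_zero]
        intro y hy
        rw [h0 x (ball_mono R.le_succ hx), h0 y (mem_ball_succ_of_adj hx (G.mem_nbrs.1 hy))]
        simp
      have h2 := hb.laplacian_ge (g := γ) (x := x) (hγ0 x) (fun z _ => hγ0 z)
      simpa [h1] using h2
    · have h1 := CDAt_zero_of_curvature_nonneg (hcurv x hx) f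
      rw [gamma₂_self_of_harmonic hf, zero_mul] at h1
      linarith
  have hsq : ∀ x, (f * f) x ≤ A ^ 2 := fun x => by
    rw [Pi.mul_apply, ← sq, ← sq_abs]
    exact pow_le_pow_left₀ (abs_nonneg _) (hA x) 2
  have hsq0 : ∀ x, 0 ≤ (f * f) x := fun x => mul_self_nonneg _
  have hup : ∀ {x : V} {t : ℝ}, (f * f) x ≤ t → (∀ z, G.graph.Adj x z → (f * f) z ≤ t) →
      2 * γ x ≤ D * (t - (f * f) x) := by
    intro x t hx h
    have h1 := hb.laplacian_ge (g := -(f * f)) (a := -t) (neg_le_neg hx)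
      (fun z hz => neg_le_neg (h z hz))
    rw [laplacian_neg, Pi.neg_apply, laplacian_sq_of_harmonic hf] at h1
    simp only [Pi.neg_apply] at h1
    linarith
  have hbdd : BddAbove (Set.range γ) := by
    refine ⟨D * A ^ 2, ?_⟩
    rintro _ ⟨x, rfl⟩
    have h1 := hup (hsq x) (fun z _ => hsq z)
    have h2 := mul_nonneg hb.upper_pos.le (hsq0 x)
    have h3 := hγ0 x
    linarith
  set M := ⨆ x, γ x
  have hM : ∀ x, γ x ≤ M := le_ciSup hbdd
  have hx₀ : f x₀ = 0 := h0 x₀ (by simp [ball])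
  rcases le_or_gt M 0 with hM0 | hM0
  · rw [← hx₀]
    exact eq_of_gamma_nonpos (fun x => (hM x).trans hM0) x x₀
  exfalso
  have hc := hb.lower_pos
  have hD := hb.upper_pos
  -- Defect at most `M / 2` means `Δ(f²) ≥ M`; if no neighbour gained `M / (2 * D)`, then `Δ(f²) ≤ M
  -- / 2`.
  obtain ⟨ε, hε, H⟩ := exists_le_defect (δ := fun x => M - γ x) (h := f * f) (A := A ^ 2) (B := 0)
    (c := M / (2 * D)) (η := M / 2) (K := D / c) (by positivity) (by positivity) (by positivity)
    hsq hsq0 (fun x hx => by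
      obtain ⟨y, hxy, hy⟩ : ∃ y, G.graph.Adj x y ∧ (f * f) x + M / (2 * D) ≤ (f * f) y := by
        by_contra! hcon
        have h1 := hup (x := x) (t := (f * f) x + M / (2 * D))
          (le_add_of_nonneg_right (by positivity)) (fun z hz => (hcon z hz).le)
        have h2 : D * ((f * f) x + M / (2 * D) - (f * f) x) = M / 2 := by
          field_simp
          ring
        linarith
      refine ⟨y, ?_, hy⟩
      have h1 := hb.harnack (g := -γ) (a := -M) (neg_le_neg (hM x))
        (fun z _ => neg_le_neg (hM z)) hxy
      rw [laplacian_neg] at h1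
      simp only [Pi.neg_apply] at h1
      rw [div_mul_eq_mul_div, le_div_iff₀ hc]
      linarith [hsub x])
  have : Nonempty V := ⟨x₀⟩
  have : M ≤ M - ε := ciSup_le fun x => by linarith [H x]
  linarith

/-! ### Nonnegative Ollivier curvature -/

theorem grad_of_adj {x y : V} (h : G.graph.Adj x y) (f : V → ℝ) : G.grad x y f = f x - f y := by
  simp [grad, SimpleGraph.dist_eq_one_iff_adj.2 h]

theorem laplacian_le_of_ollivier {x y : V} (hxy : G.graph.Adj x y)
    (hκ : 0 ≤ G.ollivierCurvature x y) {g : V → ℝ}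
    (hg : ∀ a b, G.graph.Adj a b → g b - g a ≤ 1) (h1 : g y - g x = 1) :
    G.laplacian g y ≤ G.laplacian g x := by
  have h2 : G.grad y x g = 1 := by rw [grad_of_adj hxy.symm, h1]
  have h3 : G.GradSupEq g 1 := by
    refine ⟨?_, fun r hr => hr ⟨y, x, hxy.symm, h2.symm⟩⟩
    rintro _ ⟨a, b, hab, rfl⟩
    rw [grad_of_adj hab]
    exact hg b a hab.symm
  have h4 : (0 : EReal) ≤ ((G.grad x y (G.laplacian g) : ℝ) : EReal) :=
    hκ.trans (iInf_le_of_le g (iInf_le_of_le h2 (iInf_le_of_le h3 le_rfl)))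
  rw [grad_of_adj hxy] at h4
  have h5 : (0 : ℝ) ≤ G.laplacian g x - G.laplacian g y := by exact_mod_cast h4
  linarith

/-- The largest `1`-Lipschitz function that agrees with a given `1`-Lipschitz function `F` on the
closed neighbourhood of `x`. -/
theorem exists_lipschitz_extension (F : V → ℝ) (hF : ∀ a b, G.graph.Adj a b → F b - F a ≤ 1)
    (x : V) : ∃ g : V → ℝ, (∀ a b, G.graph.Adj a b → g b - g a ≤ 1) ∧ (∀ u, F u ≤ g u) ∧
      g x = F x ∧ (∀ v, G.graph.Adj x v → g v = F v) ∧
      ∀ u, ∃ v, (v = x ∨ G.graph.Adj x v) ∧ g u = F v + G.graph.dist u v := by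
  classical
  set N : Finset V := insert x (G.nbrs x)
  have hN : N.Nonempty := Finset.insert_nonempty _ _
  have hmem : ∀ v, v ∈ N ↔ v = x ∨ G.graph.Adj x v := fun v => by
    rw [Finset.mem_insert, mem_nbrs]
  set g : V → ℝ := fun u => N.inf' hN fun v => F v + G.graph.dist u v
  have hle : ∀ u, ∀ v ∈ N, g u ≤ F v + G.graph.dist u v := fun u v hv =>
    Finset.inf'_le (fun v => F v + (G.graph.dist u v : ℝ)) hv
  have hex : ∀ u, ∃ v ∈ N, g u = F v + G.graph.dist u v := fun u =>
    Finset.exists_mem_eq_inf' hN _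
  have hge : ∀ u, F u ≤ g u := fun u => by
    obtain ⟨v, _, h⟩ := hex u
    linarith [G.sub_le_dist hF u v]
  have heq : ∀ u ∈ N, g u = F u := fun u hu =>
    le_antisymm (by simpa using hle u u hu) (hge u)
  refine ⟨g, fun a b hab => ?_, hge, heq x ((hmem x).2 (Or.inl rfl)),
    fun v hv => heq v ((hmem v).2 (Or.inr hv)), fun u => ?_⟩
  · obtain ⟨v, hv, h⟩ := hex a
    have h1 := hle b v hv
    have h2 : (G.graph.dist b v : ℝ) ≤ G.graph.dist a v + 1 := by
      exact_mod_cast G.dist_le_dist_add_one hab.symm v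
    linarith
  · obtain ⟨v, hv, h⟩ := hex u
    exact ⟨v, (hmem v).1 hv, h⟩

/-- Along an edge of almost maximal gradient, a harmonic function climbs to another such edge. -/
theorem RateBounds.exists_next_edge {c D : ℝ} (hb : G.RateBounds c D) {f : V → ℝ}
    (hf : G.laplacian f = 0) (hlip : ∀ a b, G.graph.Adj a b → f b - f a ≤ 1) {x y : V}
    (hxy : G.graph.Adj x y) (hκ : 0 ≤ G.ollivierCurvature x y) (h4 : 1 - (f y - f x) ≤ 1 / 4)
    (hcD : 1 - (f y - f x) ≤ c / (4 * D)) :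
    ∃ z' z, G.graph.Adj z' z ∧ 1 - (f z - f z') ≤ 2 * D / c * (1 - (f y - f x)) ∧
      f y + c / (2 * D) ≤ f z := by
  have hc := hb.lower_pos
  have hD := hb.upper_pos
  set ε := 1 - (f y - f x) with hε
  have hε0 : 0 ≤ ε := sub_nonneg.2 (hlip x y hxy)
  -- Since `f x` lies at least `3/4` below `f y`, harmonicity at `y` forces a compensating higher
  -- neighbour.
  obtain ⟨z, hyz, hz⟩ : ∃ z, G.graph.Adj y z ∧ f y + c / (2 * D) ≤ f z := by
    by_contra! hcon
    have h1 := hb.harnack (g := -f) (a := -(f y + c / (2 * D))) (x := y) (y := x)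
      (neg_le_neg (le_add_of_nonneg_right (by positivity)))
      (fun z hz => neg_le_neg (hcon z hz).le) hxy.symm
    rw [laplacian_neg, hf] at h1
    simp only [Pi.neg_apply, Pi.zero_apply, neg_zero, zero_add] at h1
    have h2 : D * (-f y - -(f y + c / (2 * D))) = c / 2 := by
      field_simp
      ring
    have h3 : c * (3 / 4) ≤ c * (-f x - -(f y + c / (2 * D))) := by
      refine mul_le_mul_of_nonneg_left ?_ hc.le
      have : 0 ≤ c / (2 * D) := by positivity
      linarith
    linarith
  -- Raising `f` by at most `ε` makes the increment along the edge exactly one, as the definition of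
  -- curvature requires.
  set F : V → ℝ := fun u => max (f u) (f x + 1 - G.graph.dist u y) with hFdef
  have hFlip : ∀ a b, G.graph.Adj a b → F b - F a ≤ 1 := by
    intro a b hab
    have h1 : (G.graph.dist a y : ℝ) ≤ G.graph.dist b y + 1 := by
      exact_mod_cast G.dist_le_dist_add_one hab y
    have h2 := hlip a b hab
    have h3 : F b ≤ F a + 1 := max_le
      (by linarith [le_max_left (f a) (f x + 1 - G.graph.dist a y)])
      (by linarith [le_max_right (f a) (f x + 1 - G.graph.dist a y)])
    linarith
  have hfF : ∀ u, f u ≤ F u := fun u => le_max_left _ _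
  have hFf : ∀ u, F u ≤ f u + ε := fun u => max_le (by linarith) (by
    have := G.sub_le_dist hlip y u
    rw [SimpleGraph.dist_comm] at this
    linarith)
  have hFx : F x = f x := by
    simp [hFdef, SimpleGraph.dist_eq_one_iff_adj.2 hxy]
  have hFy : F y = f x + 1 := by
    simp only [hFdef, SimpleGraph.dist_self, Nat.cast_zero, sub_zero]
    exact max_eq_right (by linarith)
  obtain ⟨g, hglip, hFg, hgx, hgN, hgex⟩ := exists_lipschitz_extension F hFlip x
  have hΔ := laplacian_le_of_ollivier hxy hκ hglip (by rw [hgx, hgN y hxy, hFx, hFy]; ring)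
  have hΔx : G.laplacian g x ≤ D * ε := by
    have h1 := hb.laplacian_ge (g := f - g) (a := -ε) (x := x)
      (by simp [hgx, hFx, hε0])
      (fun v hv => by rw [Pi.sub_apply, hgN v hv]; linarith [hFf v])
    rw [laplacian_sub, hf] at h1
    simp only [Pi.sub_apply, Pi.zero_apply, hgx, hFx] at h1
    linarith
  -- Curvature gives `Δg(y) ≤ Δg(x) ≤ D * ε`; Harnack for `g - f ≥ 0` at `y` carries the bound to
  -- `z`.
  have hgz : g z - f z ≤ 2 * D / c * ε := by
    have h1 := hb.harnack (g := g - f) (a := 0) (x := y) (y := z)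
      (by linarith [hfF y, hFg y, show (g - f) y = g y - f y from rfl])
      (fun v _ => by linarith [hfF v, hFg v, show (g - f) v = g v - f v from rfl]) hyz
    rw [laplacian_sub, hf] at h1
    simp only [Pi.sub_apply, Pi.zero_apply, sub_zero] at h1
    have h2 : g y - f y ≤ ε := by
      rw [hgN y hxy]
      linarith [hFf y]
    have h3 := mul_le_mul_of_nonneg_left h2 hD.le
    rw [div_mul_eq_mul_div, le_div_iff₀ hc]
    linarith
  obtain ⟨v, hv, hgv⟩ := hgex z
  have hfv : f v ≤ f x + 1 := by
    rcases hv with rfl | hv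
    · linarith
    · linarith [hlip x v hv]
  -- `f v ≤ f y + ε`, while `z` is higher by `c / (2 * D) > ε`. So a geodesic from `z` to `v` has a
  -- first edge; as `g` has slope one along it and is close to `f` at `z`, that edge is nearly
  -- maximal for `f`.
  have hne : z ≠ v := by
    rintro rfl
    have : c / (4 * D) < c / (2 * D) := div_lt_div_of_pos_left hc (by positivity) (by linarith)
    linarith
  obtain ⟨z', hzz', hd⟩ := G.exists_adj_dist_add_one hne
  refine ⟨z', z, hzz'.symm, ?_, hz⟩
  have h1 := G.sub_le_dist hlip z' v
  have h2 : (G.graph.dist z' v : ℝ) + 1 = G.graph.dist z v := by exact_mod_cast hd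
  linarith [hfF v]

/-- After scaling the supremum of edge increments to one, `exists_next_edge` applies to every nearly
maximal edge: `f` is constant on edges meeting the ball, so both endpoints lie outside it. -/
theorem RateBounds.eq_zero_of_nonnegOllivierOutside {c D : ℝ} (hb : G.RateBounds c D) {f : V → ℝ}
    {x₀ : V} {R : ℕ} (hcurv : G.NonnegOllivierOutside (G.ball x₀ R)) (hf : G.laplacian f = 0)
    {A : ℝ} (hA : ∀ x, |f x| ≤ A) (h0 : ∀ x ∈ G.ball x₀ (R + 1), f x = 0) (x : V) : f x = 0 := by
  have hx₀ : f x₀ = 0 := h0 x₀ (by simp [ball])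
  have hc := hb.lower_pos
  have hD := hb.upper_pos
  by_contra hfx
  obtain ⟨a, b, hab, hlt⟩ : ∃ a b, G.graph.Adj a b ∧ f a < f b := by
    by_contra! hcon
    refine hfx (G.forall_of_adj_closed (p := fun y => f y = 0) hx₀ (fun a b hab ha => ?_) x)
    exact le_antisymm (ha ▸ hcon a b hab) (ha ▸ hcon b a hab.symm)
  let E := {p : V × V // G.graph.Adj p.1 p.2}
  let φ : E → ℝ := fun p => f p.1.2 - f p.1.1
  have hbdd : BddAbove (Set.range φ) := by
    refine ⟨2 * A, ?_⟩
    rintro _ ⟨p, rfl⟩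
    have h1 := abs_le.1 (hA p.1.1)
    have h2 := abs_le.1 (hA p.1.2)
    simp only [φ]
    linarith
  set L := ⨆ p, φ p
  have hL : ∀ p, φ p ≤ L := le_ciSup hbdd
  have hL0 : 0 < L := (sub_pos.2 hlt).trans_le (hL ⟨(a, b), hab⟩)
  set F : V → ℝ := L⁻¹ • f with hFdef
  have hF : ∀ u v, F v - F u = (f v - f u) / L := fun u v => by
    simp only [hFdef, Pi.smul_apply, smul_eq_mul]
    ring
  have hFharm : G.laplacian F = 0 := by rw [hFdef, laplacian_smul, hf, smul_zero]
  have hFlip : ∀ u v, G.graph.Adj u v → F v - F u ≤ 1 := fun u v huv => by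
    rw [hF, div_le_one hL0]
    exact hL ⟨(u, v), huv⟩
  have hFbd : ∀ u, |F u| ≤ L⁻¹ * A := fun u => by
    simp only [hFdef, Pi.smul_apply, smul_eq_mul, abs_mul, abs_of_pos (inv_pos.2 hL0)]
    exact mul_le_mul_of_nonneg_left (hA u) (inv_pos.2 hL0).le
  have hout : ∀ u v, G.graph.Adj u v → F v - F u ≠ 0 → u ∉ G.ball x₀ R := fun u v huv hne hu => by
    rw [hF, h0 u (ball_mono R.le_succ hu), h0 v (mem_ball_succ_of_adj hu huv)] at hne
    simp at hne
  obtain ⟨ε, hε, H⟩ := exists_le_defect (α := E) (δ := fun p => 1 - (F p.1.2 - F p.1.1))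
    (h := fun p => F p.1.2) (A := L⁻¹ * A) (B := -(L⁻¹ * A)) (c := c / (2 * D))
    (η := min (1 / 4) (c / (4 * D))) (K := 2 * D / c) (by positivity) (by positivity)
    (by positivity) (fun p => (abs_le.1 (hFbd _)).2) (fun p => (abs_le.1 (hFbd _)).1)
    (fun ⟨(u, v), huv⟩ hp => by
      simp only at hp huv
      have h4 := hp.trans (min_le_left _ _)
      have hne : F v - F u ≠ 0 := fun h => by
        rw [h] at h4
        norm_num at h4
      obtain ⟨z', z, hzz, h1, h2⟩ := hb.exists_next_edge hFharm hFlip huv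
        (hcurv u v (hout u v huv hne)
          (hout v u huv.symm (fun h => hne (by linarith))) huv) h4
        (hp.trans (min_le_right _ _))
      exact ⟨⟨(z', z), hzz⟩, h1, h2⟩)
  have : Nonempty E := ⟨⟨(a, b), hab⟩⟩
  have hle : L ≤ L * (1 - ε) := ciSup_le fun p => by
    have h1 := H p
    simp only [hF] at h1
    have h2 : (f p.1.2 - f p.1.1) / L ≤ 1 - ε := by linarith
    rw [div_le_iff₀ hL0] at h2
    simp only [φ]
    linarith
  have := mul_pos hL0 hε
  linarith

end WeightedGraph

namespace WeightedGraph

variable {V : Type*} {G : WeightedGraph V}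

/-! ### Least harmonic majorants -/

/-- As the total jump rate is at most `D`, `s + Δs / D` is an average of `s` with nonnegative
weights. -/
theorem RateBounds.average_mono {c D : ℝ} (hb : G.RateBounds c D) {s t : V → ℝ}
    (h : ∀ x, s x ≤ t x) (x : V) :
    s x + G.laplacian s x / D ≤ t x + G.laplacian t x / D := by
  have hD := hb.upper_pos
  have h1 := hb.laplacian_ge (g := t - s) (a := 0) (x := x) (sub_nonneg.2 (h x))
    (fun z _ => sub_nonneg.2 (h z))
  rw [laplacian_sub] at h1
  simp only [Pi.sub_apply, sub_zero] at h1
  have h2 : t x + G.laplacian t x / D - (s x + G.laplacian s x / D) =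
      (G.laplacian t x - G.laplacian s x + D * (t x - s x)) / D := by
    field_simp
    ring
  have h3 := div_nonneg h1 hD.le
  linarith

/-- A function that is subharmonic on `E`, lies between `0` and `1` and vanishes outside `E` has a
least majorant that is harmonic on `E`. -/
theorem RateBounds.exists_harmonic_majorant {c D : ℝ} (hb : G.RateBounds c D) {E : Set V}
    {v : V → ℝ} (h1 : ∀ x, v x ≤ 1) (hE : ∀ x ∉ E, v x = 0)
    (hv : ∀ x ∈ E, 0 ≤ G.laplacian v x) :
    ∃ h : V → ℝ, (∀ x, v x ≤ h x) ∧ (∀ x, h x ≤ 1) ∧ (∀ x ∉ E, h x = 0) ∧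
      (∀ x ∈ E, G.laplacian h x = 0) ∧
      ∀ s : V → ℝ, (∀ x, v x ≤ s x) → (∀ x ∈ E, G.laplacian s x ≤ 0) → ∀ x, h x ≤ s x := by
  classical
  have hD := hb.upper_pos
  let S : Set (V → ℝ) := {s | (∀ x, v x ≤ s x) ∧ ∀ x ∈ E, G.laplacian s x ≤ 0}
  have hone : (fun _ => 1 : V → ℝ) ∈ S := ⟨h1, fun x _ => by simp [laplacian_const]⟩
  have : Nonempty S := ⟨⟨_, hone⟩⟩
  let h : V → ℝ := fun x => ⨅ s : S, s.1 x
  have hle : ∀ s ∈ S, ∀ x, h x ≤ s x := fun s hs x =>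
    ciInf_le ⟨v x, by rintro _ ⟨s, rfl⟩; exact s.2.1 x⟩ (⟨s, hs⟩ : S)
  have hvh : ∀ x, v x ≤ h x := fun x => le_ciInf fun s => s.2.1 x
  -- Perron's method: averaging the infimum `h` once on `E` gives another competitor below it, so
  -- `h` is fixed by averaging, i.e. harmonic on `E`.
  let h' : V → ℝ := fun x => if x ∈ E then h x + G.laplacian h x / D else v x
  have hPh : ∀ x ∈ E, h x + G.laplacian h x / D ≤ h x := fun x hx => le_ciInf fun s =>
    (hb.average_mono (hle s.1 s.2) x).trans
      (add_le_of_nonpos_right (div_nonpos_of_nonpos_of_nonneg (s.2.2 x hx) hD.le))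
  have hh' : ∀ x, h' x ≤ h x := fun x => by
    by_cases hx : x ∈ E
    · simpa only [h', if_pos hx] using hPh x hx
    · simpa only [h', if_neg hx] using hvh x
  have hS : h' ∈ S := by
    refine ⟨fun x => ?_, fun x hx => ?_⟩
    · by_cases hx : x ∈ E
      · simp only [h', if_pos hx]
        exact (le_add_of_nonneg_right (div_nonneg (hv x hx) hD.le)).trans
          (hb.average_mono hvh x)
      · simp only [h', if_neg hx, le_refl]
    · have h2 := hb.average_mono hh' x
      have h3 : h' x = h x + G.laplacian h x / D := if_pos hx
      by_contra! hpos
      have := div_pos hpos hD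
      linarith
  have heq : ∀ x, h x = h' x := fun x => le_antisymm (hle h' hS x) (hh' x)
  refine ⟨h, hvh, hle _ hone, fun x hx => ?_, fun x hx => ?_, fun s hs hs' => hle s ⟨hs, hs'⟩⟩
  · rw [heq x]
    simp only [h', if_neg hx, hE x hx]
  · have h3 := heq x
    simp only [h', if_pos hx] at h3
    have h4 : G.laplacian h x / D = 0 := by linarith
    exact (div_eq_zero_iff.1 h4).resolve_right hD.ne'

/-! ### Massive sets -/

/-- `v` witnesses that `E` is massive: it is a bounded subharmonic function supported in `E`,
normalised to have supremum `1`. -/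
structure IsMassiveWitness (G : WeightedGraph V) (E : Set V) (v : V → ℝ) : Prop where
  nonneg : ∀ x, 0 ≤ v x
  eq_zero : ∀ x ∉ E, v x = 0
  subharmonic : ∀ x, 0 ≤ G.laplacian v x
  isLUB : IsLUB (Set.range v) 1

/-- A massive set carries a nontrivial bounded subharmonic function that vanishes outside. -/
def IsMassive (G : WeightedGraph V) (E : Set V) : Prop := ∃ v, G.IsMassiveWitness E v

theorem IsMassiveWitness.le_one {E : Set V} {v : V → ℝ} (h : G.IsMassiveWitness E v) (x : V) :
    v x ≤ 1 := h.isLUB.1 ⟨x, rfl⟩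

theorem IsMassiveWitness.exists_gt {E : Set V} {v : V → ℝ} (h : G.IsMassiveWitness E v) {a : ℝ}
    (ha : a < 1) : ∃ x, a < v x := by
  obtain ⟨_, ⟨x, rfl⟩, hx⟩ := (lt_isLUB_iff h.isLUB).1 ha
  exact ⟨x, hx⟩

theorem IsMassiveWitness.lt_one {c D : ℝ} (hb : G.RateBounds c D) {E : Set V} {v : V → ℝ}
    (h : G.IsMassiveWitness E v) (hE : E ≠ Set.univ) (x : V) : v x < 1 := by
  obtain ⟨y, hy⟩ := (Set.ne_univ_iff_exists_notMem E).1 hE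
  refine (h.le_one x).lt_of_ne fun hx => ?_
  have := hb.eq_of_max (x := x) h.subharmonic (fun z => hx ▸ h.le_one z) y
  rw [h.eq_zero y hy, hx] at this
  exact zero_ne_one this

/-- By the strong maximum principle the supremum one is not attained, so no finite set can contain
all the large values. -/
theorem IsMassiveWitness.infinite_gt {c D : ℝ} (hb : G.RateBounds c D) {E : Set V} {v : V → ℝ}
    (h : G.IsMassiveWitness E v) (hE : E ≠ Set.univ) {a : ℝ} (ha : a < 1) :
    {x | a < v x}.Infinite := by
  intro hfin
  obtain ⟨y, hy⟩ := h.exists_gt ha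
  obtain ⟨z, hz, hmax⟩ := hfin.exists_maximalFor v _ ⟨y, hy⟩
  obtain ⟨u, hu⟩ := h.exists_gt (h.lt_one hb hE z)
  have hu' : a < v u := lt_trans hz hu
  exact absurd (hmax hu' hu.le) (not_le.2 hu)

/-- Nonnegative bounded subharmonic functions can be normalised. -/
theorem IsMassive.of_subharmonic {E : Set V} {v : V → ℝ} {A : ℝ} (h0 : ∀ x, 0 ≤ v x)
    (hA : ∀ x, v x ≤ A) (hE : ∀ x ∉ E, v x = 0) (hv : ∀ x ∈ E, 0 < v x → 0 ≤ G.laplacian v x)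
    {x : V} (hx : 0 < v x) : G.IsMassive E := by
  have hbdd : BddAbove (Set.range v) := ⟨A, by rintro _ ⟨y, rfl⟩; exact hA y⟩
  set s := ⨆ y, v y
  have hs : ∀ y, v y ≤ s := le_ciSup hbdd
  have hs0 : 0 < s := hx.trans_le (hs x)
  have hsub : ∀ y, 0 ≤ G.laplacian v y := fun y => by
    rcases (h0 y).eq_or_lt with hy | hy
    · have := G.laplacian_mono_of_le (f := fun _ => 0) (g := v) hy (fun z _ => h0 z)
      rwa [laplacian_const] at this
    · exact hv y (by_contra fun h => hy.ne' (hE y h)) hy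
  refine ⟨s⁻¹ • v, fun y => ?_, fun y hy => ?_, fun y => ?_, ?_, fun B hB => ?_⟩
  · exact mul_nonneg (inv_pos.2 hs0).le (h0 y)
  · simp [hE y hy]
  · rw [laplacian_smul]
    exact mul_nonneg (inv_pos.2 hs0).le (hsub y)
  · rintro _ ⟨y, rfl⟩
    simp only [Pi.smul_apply, smul_eq_mul]
    rw [inv_mul_le_one₀ hs0]
    exact hs y
  · have : Nonempty V := ⟨x⟩
    have : s ≤ s * B := ciSup_le fun y => by
      have := hB ⟨y, rfl⟩
      simp only [Pi.smul_apply, smul_eq_mul] at this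
      rwa [inv_mul_le_iff₀ hs0] at this
    exact le_of_mul_le_mul_left (by simpa using this) hs0

/-- The witness is the positive part of `1 - f`, extended by zero; the extension is subharmonic
because `f = 1` on the boundary. -/
theorem IsBarrier.isMassive {E : Set V} {f : V → ℝ} (hf : G.IsBarrier E f) : G.IsMassive E := by
  classical
  obtain ⟨hpos, hharm, hbd, hlim⟩ := hf
  obtain ⟨x, hxE, hx⟩ : ∃ x ∈ E, f x < 1 := by
    by_contra! hcon
    refine absurd hlim (not_lt.2 (le_liminf_of_le (by isBoundedDefault) ?_))
    filter_upwards [mem_inf_of_right (mem_principal_self E)] with x hx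
    exact_mod_cast hcon x hx
  set v : V → ℝ := fun y => if y ∈ E then max (1 - f y) 0 else 0 with hv
  have h0 : ∀ y, 0 ≤ v y := fun y => by
    by_cases hy : y ∈ E <;> simp [hv, hy]
  refine IsMassive.of_subharmonic (v := v) (A := 1) h0 (fun y => ?_) (fun y hy => if_neg hy)
    (fun y hyE hy => ?_) (x := x) (by simp [hv, hxE, hx])
  · by_cases hy : y ∈ E
    · simp [hv, hy, (hpos y (Or.inl hy)).le]
    · simp [hv, hy]
  · have hvy : v y = 1 - f y := by
      simp only [hv, if_pos hyE] at hy ⊢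
      exact max_eq_left_of_lt (by simpa using hy)
    have h2 := G.laplacian_one_sub f y
    rw [hharm y hyE, neg_zero] at h2
    rw [← h2]
    refine laplacian_mono_of_le G hvy.symm fun z hz => ?_
    by_cases hzE : z ∈ E
    · simp only [hv, if_pos hzE]
      exact le_max_left _ _
    · simp [hv, hzE, hbd z ⟨hzE, y, hyE, hz⟩]

theorem IsMassive.infinite {c D : ℝ} (hb : G.RateBounds c D) {E : Set V} (h : G.IsMassive E)
    (hE : E ≠ Set.univ) : E.Infinite := by
  obtain ⟨v, hv⟩ := h
  refine (hv.infinite_gt hb hE zero_lt_one).mono fun x hx => ?_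
  by_contra hxE
  exact (ne_of_gt hx) (hv.eq_zero x hxE)

theorem IsMassive.exists_isBarrier {c D : ℝ} (hb : G.RateBounds c D) {E : Set V}
    (h : G.IsMassive E) (hE : E ≠ Set.univ) : ∃ f, G.IsBarrier E f := by
  obtain ⟨v, hv⟩ := h
  obtain ⟨u, hvu, hu1, huE, hharm, -⟩ :=
    hb.exists_harmonic_majorant hv.le_one hv.eq_zero (fun x _ => hv.subharmonic x)
  -- The factor `1/2` keeps the barrier positive even where `u = 1`; it is at most `3/4` on the
  -- infinite set `v > 1/2`.
  refine ⟨(fun x => 1 - ((1 / 2 : ℝ) • u) x), fun x _ => ?_, fun x hx => ?_, fun x hx => ?_, ?_⟩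
  · simp only [Pi.smul_apply, smul_eq_mul]
    linarith [hu1 x]
  · rw [laplacian_one_sub, laplacian_smul]
    simp [hharm x hx]
  · simp [huE x hx.1]
  · refine lt_of_le_of_lt (b := ((3 / 4 : ℝ) : EReal)) ?_ 
      (by exact_mod_cast (by norm_num : (3 / 4 : ℝ) < 1))
    refine liminf_le_of_frequently_le ?_ (by isBoundedDefault)
    rw [frequently_inf_principal, frequently_cofinite_iff_infinite]
    refine (hv.infinite_gt hb hE (by norm_num : (1 / 2 : ℝ) < 1)).mono fun x hx => ?_
    have hx' : 1 / 2 < v x := hx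
    refine ⟨by_contra fun hxE => ?_, ?_⟩
    · rw [hv.eq_zero x hxE] at hx'
      norm_num at hx'
    · simp only [Pi.smul_apply, smul_eq_mul]
      have := hvu x
      exact_mod_cast (by linarith : 1 - 1 / 2 * u x ≤ 3 / 4)

theorem componentCompl_supp_ne_univ {Ω : Finset V} (hΩ : Ω.Nonempty)
    (C : G.graph.ComponentCompl (Ω : Set V)) : C.supp ≠ Set.univ := by
  obtain ⟨x, hx⟩ := hΩ
  exact (Set.ne_univ_iff_exists_notMem _).2 ⟨x, fun h => C.notMem_of_mem h hx⟩

theorem RateBounds.nonparabolicEnds_eq {c D : ℝ} (hb : G.RateBounds c D) {Ω : Finset V}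
    (hΩ : Ω.Nonempty) : G.nonparabolicEnds Ω = {C | G.IsMassive C.supp} := by
  ext C
  have hC := componentCompl_supp_ne_univ hΩ C
  exact ⟨fun ⟨_, f, hf⟩ => hf.isMassive, fun h => ⟨h.infinite hb hC, h.exists_isBarrier hb hC⟩⟩

/-- A massive component stays massive when the removed set is enlarged. -/
theorem IsMassive.exists_hom_eq {c D : ℝ} (hb : G.RateBounds c D) {Ω Ω' : Finset V}
    (hΩ : Ω.Nonempty) (hsub : (Ω : Set V) ⊆ Ω') {C : G.graph.ComponentCompl (Ω : Set V)}
    (hC : G.IsMassive C.supp) :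
    ∃ C' : G.graph.ComponentCompl (Ω' : Set V), G.IsMassive C'.supp ∧ C'.hom hsub = C := by
  classical
  obtain ⟨v, hv⟩ := hC
  have hΩ' : Ω'.Nonempty := hΩ.mono (by exact_mod_cast hsub)
  obtain ⟨b, hb', ha⟩ := Ω'.exists_max_image v hΩ'
  have ha1 := hv.lt_one hb (componentCompl_supp_ne_univ hΩ C) b
  set a := v b
  have ha0 : 0 ≤ a := hv.nonneg b
  obtain ⟨x, hx⟩ := hv.exists_gt ha1
  have hxΩ' : x ∉ (Ω' : Set V) := fun h => not_lt.2 (ha x h) hx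
  set C' := G.graph.componentComplMk hxΩ'
  have hxC' : x ∈ C' := G.graph.componentComplMk_mem hxΩ'
  have hxC : x ∈ C := by
    by_contra hxC
    rw [hv.eq_zero x hxC] at hx
    linarith
  refine ⟨C', ?_, ?_⟩
  swap
  · rw [SimpleGraph.ComponentCompl.hom_eq_iff_not_disjoint, Set.not_disjoint_iff]
    exact ⟨x, hxC', hxC⟩
  -- Truncating at the maximum `a < 1` of `v` on `Ω'` allows cutting off outside `C'`: neighbours of
  -- `C'` outside it lie in `Ω'`, where `v ≤ a`.
  set u : V → ℝ := fun y => if y ∈ C' then max (v y - a) 0 else 0 with hu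
  have hu0 : ∀ y, 0 ≤ u y := fun y => by
    by_cases hy : y ∈ C'
    · simp only [hu, if_pos hy, le_max_right]
    · simp only [hu, if_neg hy, le_refl]
  refine IsMassive.of_subharmonic (v := u) (A := 1) hu0 (fun y => ?_) (fun y hy => if_neg hy)
    (fun y hyE hy => ?_) (x := x) ?_
  · by_cases hy : y ∈ C'
    · simp only [hu, if_pos hy]
      exact max_le (by linarith [hv.le_one y]) zero_le_one
    · simp only [hu, if_neg hy, zero_le_one]
  · have hyC : y ∈ C' := hyE
    have huy : u y = v y - a := by
      simp only [hu, if_pos hyC] at hy ⊢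
      exact max_eq_left_of_lt (by simpa using hy)
    have h2 := congrFun (G.laplacian_sub v (fun _ => a)) y
    rw [laplacian_const, sub_zero] at h2
    refine (hv.subharmonic y).trans (h2 ▸ laplacian_mono_of_le G huy.symm fun z hz => ?_)
    by_cases hzC : z ∈ C'
    · simp only [hu, if_pos hzC]
      exact le_max_left _ _
    · have hzΩ : z ∈ Ω' := by
        by_contra hzΩ
        exact hzC (SimpleGraph.ComponentCompl.mem_of_adj y z hyC (by exact_mod_cast hzΩ) hz)
      simp only [hu, if_neg hzC, Pi.sub_apply]
      linarith [ha z hzΩ]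
  · simp only [hu, if_pos hxC']
    exact lt_max_of_lt_left (sub_pos.2 hx)

theorem RateBounds.encard_nonparabolicEnds_mono {c D : ℝ} (hb : G.RateBounds c D)
    {Ω Ω' : Finset V} (hΩ : Ω.Nonempty) (hsub : Ω ⊆ Ω') :
    (G.nonparabolicEnds Ω).encard ≤ (G.nonparabolicEnds Ω').encard := by
  have hsub' : (Ω : Set V) ⊆ Ω' := by exact_mod_cast hsub
  rw [hb.nonparabolicEnds_eq hΩ, hb.nonparabolicEnds_eq (hΩ.mono hsub)]
  refine (Set.encard_le_encard fun C hC => ?_).trans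
    (Set.encard_image_le (SimpleGraph.ComponentCompl.hom hsub') _)
  exact IsMassive.exists_hom_eq hb hΩ hsub' hC

/-! ### Counting ends by bounded harmonic functions -/

/-- Harmonic functions attached to massive witnesses with disjoint supports are linearly
independent. -/
theorem linearIndependent_of_witness {ι : Type*} {E : ι → Set V} {v u : ι → V → ℝ}
    (hv : ∀ i, G.IsMassiveWitness (E i) (v i)) (hvu : ∀ i x, v i x ≤ u i x)
    (hu1 : ∀ i x, u i x ≤ 1) (huu : ∀ i j, i ≠ j → ∀ x, u i x + u j x ≤ 1) :
    LinearIndependent ℝ u := by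
  classical
  rw [linearIndependent_iff']
  intro s a hsum j hj
  have hu0 : ∀ i x, 0 ≤ u i x := fun i x => ((hv i).nonneg x).trans (hvu i x)
  set A := ∑ i ∈ s, |a i|
  have hA : 0 ≤ A := Finset.sum_nonneg fun i _ => abs_nonneg _
  have key : ∀ ε > 0, |a j| ≤ ε * A := by
    intro ε hε
    obtain ⟨x, hx⟩ := (hv j).exists_gt (sub_lt_self 1 hε)
    have hxu := hx.trans_le (hvu j x)
    have h1 : ∑ i ∈ s, a i * u i x = 0 := by
      simpa [Finset.sum_apply] using congrFun hsum x
    have h2 : a j = a j * (1 - u j x) - ∑ i ∈ s.erase j, a i * u i x := by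
      rw [← Finset.add_sum_erase s _ hj] at h1
      linarith
    have hle := hu1 j x
    have h3 : |a j * (1 - u j x)| ≤ ε * |a j| := by
      rw [abs_mul, mul_comm]
      exact mul_le_mul_of_nonneg_right (abs_le.2 ⟨by linarith, by linarith⟩) (abs_nonneg _)
    have h4 : |∑ i ∈ s.erase j, a i * u i x| ≤ ε * ∑ i ∈ s.erase j, |a i| := by
      refine (Finset.abs_sum_le_sum_abs _ _).trans ?_
      rw [Finset.mul_sum]
      refine Finset.sum_le_sum fun i hi => ?_
      rw [abs_mul, mul_comm, abs_of_nonneg (hu0 i x)]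
      exact mul_le_mul_of_nonneg_right
        (by linarith [huu i j (Finset.ne_of_mem_erase hi) x]) (abs_nonneg _)
    calc |a j| ≤ ε * |a j| + ε * ∑ i ∈ s.erase j, |a i| := by
          conv_lhs => rw [h2]
          exact (abs_sub _ _).trans (add_le_add h3 h4)
      _ = ε * A := by rw [← mul_add, Finset.add_sum_erase s (fun i => |a i|) hj]
  by_contra hne
  -- At a point where `v j > 1 - ε`, every other `u i` is below `ε`; this `ε` makes the resulting
  -- bound less than `|a j|`.
  have h5 := key (|a j| / (2 * (A + 1))) (by positivity)
  have h6 : 0 < |a j| := abs_pos.2 hne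
  rw [div_mul_eq_mul_div, le_div_iff₀ (by positivity)] at h5
  nlinarith

/-- The massive sets among pairwise disjoint sets are at most as many as the vertices of a finite
set on which bounded harmonic functions are determined by their values. -/
theorem RateBounds.encard_le_of_unique {c D : ℝ} (hb : G.RateBounds c D) {ι : Type*}
    {E : ι → Set V} (hE : ∀ i, G.IsMassive (E i)) (hdisj : Pairwise fun i j => Disjoint (E i) (E j))
    {S : Set V} (hS : S.Finite)
    (huniq : ∀ f : V → ℝ, G.laplacian f = 0 → (∃ A, ∀ x, |f x| ≤ A) → (∀ x ∈ S, f x = 0) → f = 0) :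
    ENat.card ι ≤ S.encard := by
  classical
  choose v hv using hE
  have hmaj := fun i => hb.exists_harmonic_majorant (E := Set.univ) (hv i).le_one
    (fun x hx => absurd (Set.mem_univ x) hx) (fun x _ => (hv i).subharmonic x)
  choose u hvu hu1 _ hharm hleast using hmaj
  have hu0 : ∀ i x, 0 ≤ u i x := fun i x => ((hv i).nonneg x).trans (hvu i x)
  have huh : ∀ i, G.laplacian (u i) = 0 := fun i => funext fun x => hharm i x trivial
  have hvv : ∀ i j, i ≠ j → ∀ x, v i x ≤ 1 - v j x := by
    intro i j hij x
    by_cases hx : x ∈ E i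
    · rw [(hv j).eq_zero x (Set.disjoint_left.1 (hdisj hij) hx), sub_zero]
      exact (hv i).le_one x
    · rw [(hv i).eq_zero x hx]
      linarith [(hv j).le_one x]
  have huv : ∀ i j, i ≠ j → ∀ x, u i x ≤ 1 - v j x := fun i j hij =>
    hleast i (fun x => 1 - v j x) (hvv i j hij) (fun x _ => by
      rw [laplacian_one_sub]
      exact neg_nonpos.2 ((hv j).subharmonic x))
  -- Leastness is used twice: `1 - v i` dominates `v j`, hence `u j`; then the harmonic `1 - u j`
  -- dominates `v i`, hence `u i`.
  have huu : ∀ i j, i ≠ j → ∀ x, u i x + u j x ≤ 1 := fun i j hij x => by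
    have := hleast i (fun x => 1 - u j x) (fun x => by linarith [huv j i hij.symm x])
      (fun x _ => by rw [laplacian_one_sub, huh j]; simp) x
    linarith
  have hli := linearIndependent_of_witness hv hvu hu1 huu
  let res : (V → ℝ) →ₗ[ℝ] (S → ℝ) := LinearMap.funLeft ℝ ℝ Subtype.val
  have hli' : LinearIndependent ℝ (res ∘ u) := by
    rw [linearIndependent_iff']
    intro s a hsum
    refine linearIndependent_iff'.1 hli s a
      (huniq _ ?_ ⟨∑ i ∈ s, |a i|, fun x => ?_⟩ fun x hx => ?_)
    · rw [laplacian_sum]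
      exact Finset.sum_eq_zero fun i _ => by rw [laplacian_smul, huh i, smul_zero]
    · rw [Finset.sum_apply]
      refine (Finset.abs_sum_le_sum_abs _ _).trans (Finset.sum_le_sum fun i _ => ?_)
      rw [Pi.smul_apply, smul_eq_mul, abs_mul, abs_of_nonneg (hu0 i x)]
      exact mul_le_of_le_one_right (abs_nonneg _) (hu1 i x)
    · have := congrFun hsum ⟨x, hx⟩
      simpa [res, Finset.sum_apply, LinearMap.funLeft_apply] using this
  have := hS.fintype
  have hfin : Finite ι := hli'.finite
  have := Fintype.ofFinite ι
  have hcard := hli'.fintype_card_le_finrank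
  rw [Module.finrank_fintype_fun_eq_card] at hcard
  rw [ENat.card_eq_coe_fintype_card, ← Set.coe_fintypeCard]
  exact_mod_cast hcard

theorem RateBounds.encard_nonparabolicEnds_le {c D : ℝ} (hb : G.RateBounds c D) {x₀ : V} {R : ℕ}
    (hcurv : G.CDOutside (G.ball x₀ R) ∨ G.NonnegOllivierOutside (G.ball x₀ R))
    {Ω : Finset V} (hΩ : Ω.Nonempty) :
    (G.nonparabolicEnds Ω).encard ≤ (G.sphere x₀ (R + 1)).encard := by
  rcases (G.nonparabolicEnds Ω).eq_empty_or_nonempty with h | ⟨C, hC⟩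
  · simp [h]
  -- An infinite end rules out a graph equal to the ball of radius `R`, where the maximum principle
  -- would have no sphere to use.
  have hS : (G.sphere x₀ (R + 1)).Nonempty := by
    rw [Set.nonempty_iff_ne_empty]
    intro h
    have hfin := G.finite_ball x₀ R
    rw [G.ball_eq_univ_of_sphere_eq_empty h] at hfin
    exact hC.1 (hfin.subset (Set.subset_univ _))
  rw [hb.nonparabolicEnds_eq hΩ]
  refine hb.encard_le_of_unique (ι := {C : G.graph.ComponentCompl (Ω : Set V) | G.IsMassive C.supp})
    (E := fun C => C.1.supp) (fun C => C.2)
    (fun C C' h => SimpleGraph.ComponentCompl.pairwise_disjoint (Subtype.coe_injective.ne h))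
    (G.finite_sphere _ _) fun f hf ⟨A, hA⟩ h0 => funext fun x => ?_
  have h1 := hb.eq_zero_on_ball hf hS h0
  rcases hcurv with hcurv | hcurv
  · exact hb.eq_zero_of_CDOutside hcurv hf hA h1 x
  · exact hb.eq_zero_of_nonnegOllivierOutside hcurv hf hA h1 x

/-! ### Exhaustions -/

theorem exists_isExhaustion (G : WeightedGraph V) (x₀ : V) : ∃ Ω, IsExhaustion (V := V) Ω := by
  refine ⟨fun i => (G.finite_ball x₀ i).toFinset, fun i => ?_, fun x => ⟨G.graph.dist x x₀, ?_⟩⟩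
  · simpa only [Set.Finite.toFinset_subset_toFinset] using ball_mono i.le_succ
  · simp [ball]

theorem IsExhaustion.eventually_subset {Ω : ℕ → Finset V} (h : IsExhaustion Ω) (F : Finset V) :
    ∀ᶠ i in atTop, F ⊆ Ω i := by
  have hmono : Monotone Ω := monotone_nat_of_le_succ h.1
  have : ∀ᶠ i in atTop, ∀ x ∈ F, x ∈ Ω i := by
    rw [Finset.eventually_all]
    intro x _
    obtain ⟨i, hi⟩ := h.2 x
    exact eventually_atTop.2 ⟨i, fun j hj => hmono hj hi⟩
  exact this

end WeightedGraph

/-! ### The limit and its bound. -/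

theorem corollary1p4 {V : Type*} (G : WeightedGraph V) (hG : G.BoundedGeometry)
    (x₀ : V) (R₀ : ℕ)
    (hcurv : G.CDOutside (G.ball x₀ R₀) ∨ G.NonnegOllivierOutside (G.ball x₀ R₀)) :
    ∃ N : ℕ, G.HasNonparabolicEndCount N ∧ (N : ℕ∞) ≤ (G.sphere x₀ (R₀ + 1)).encard := by
  obtain ⟨c, D, hb⟩ := hG.exists_rateBounds
  have hle := fun (Ω : Finset V) (hΩ : Ω.Nonempty) => hb.encard_nonparabolicEnds_le hcurv hΩ
  have hS := (G.finite_sphere x₀ (R₀ + 1)).encard_lt_top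
  obtain ⟨k, hk⟩ := ENat.ne_top_iff_exists.1 hS.ne
  -- The empty set is excluded: for it, on an infinite graph, the constant `1/2` is a barrier on
  -- `V`, which has no boundary, so monotonicity could fail.
  let T : Set ℕ := {n | ∃ Ω : Finset V, Ω.Nonempty ∧ (G.nonparabolicEnds Ω).encard = n}
  have hT : ∀ Ω : Finset V, Ω.Nonempty → ∃ n ∈ T, (G.nonparabolicEnds Ω).encard = n :=
    fun Ω hΩ => by
      obtain ⟨n, hn⟩ := ENat.ne_top_iff_exists.1 ((hle Ω hΩ).trans_lt hS).ne
      exact ⟨n, ⟨Ω, hΩ, hn.symm⟩, hn.symm⟩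
  have hbdd : BddAbove T := ⟨k, fun n ⟨Ω, hΩ, hn⟩ => by
    have := hle Ω hΩ
    rw [hn, ← hk] at this
    exact_mod_cast this⟩
  have hne : T.Nonempty := by
    obtain ⟨n, hn, -⟩ := hT {x₀} (Finset.singleton_nonempty x₀)
    exact ⟨n, hn⟩
  obtain ⟨Ω₀, hΩ₀, hN⟩ := Nat.sSup_mem hne hbdd
  refine ⟨sSup T, ⟨G.exists_isExhaustion x₀, fun Ω hΩ => ?_⟩, hN ▸ hle Ω₀ hΩ₀⟩
  refine tendsto_const_nhds.congr' ?_
  filter_upwards [hΩ.eventually_subset Ω₀] with i hi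
  refine le_antisymm (hN ▸ hb.encard_nonparabolicEnds_mono hΩ₀ hi) ?_
  obtain ⟨n, hn, hn'⟩ := hT (Ω i) (hΩ₀.mono hi)
  rw [hn']
  exact_mod_cast le_csSup hbdd hn
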